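/- **Kazhdan–Margulis–Zassenhaus lemma for Hilbert geometries.** Let $\mathbb{P}^n$ be the real projective space of lines of $\mathbb{R}^{n+1}$. An affine chart is the complement of a projective hyperplane, with its natural affine structure. An open set $\Omega\subset\mathbb{P}^n$ is *properly convex* if it is contained in an affine chart, is convex in this chart, and its closure $\overline\Omega$ is contained in some affine chart. For such an $\Omega$, the Hilbert distance $d_\Omega$ on $\Omega$ is given by $d_\Omega(x,x)=0$ and, for $x\neq y$ in $\Omega$, by $$d_\Omega(x,y)=\frac12\ln\frac{\|a-x\|\cdot\|b-y\|}{\|a-y\|\cdot\|b-x\|},$$ where, in an affine chart containing $\overline\Omega$ and endowed with a Euclidean norm $\|\cdot\|$, the points $a,b$ are the intersections of the line $(xy)$ with the boundary $\partial\Omega$ such that $x$ lies between $b$ and $y$, and $y$ lies between $x$ and $a$ (the value does not depend on the chart or the norm). Let $\mathrm{Aut}(\Omega)$ be the subgroup of the elements of $\mathrm{SL}_{n+1}(\mathbb{R})$ whose action on $\mathbb{P}^n$ preserves $\Omega$. For every dimension $n$ there exist a constant $\varepsilon_n>0$ and an integer $m_n$, depending only on $n$, such that for every properly convex open set $\Omega\subset\mathbb{P}^n$,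 every discrete subgroup $\Gamma$ of $\mathrm{Aut}(\Omega)$ and every point $x\in\Omega$, the subgroup $\Gamma_{\varepsilon_n}$ of $\Gamma$ generated by $\{\gamma\in\Gamma : d_\Omega(x,\gamma\cdot x)\le\varepsilon_n\}$ is virtually nilpotent; moreover, $\Gamma_{\varepsilon_n}$ has a nilpotent subgroup of (finite) index at most $m_n$. -/

import Mathlib

open scoped LinearAlgebra.Projectivization MatrixGroups Pointwise

namespace HilbertGeometry

/-- The real projective space `ℙⁿ`, the space of lines of `ℝⁿ⁺¹`. -/
abbrev ProjSpace (n : ℕ) : Type := ℙ ℝ (Fin (n + 1) → ℝ)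

/-- The quotient topology on `ℙⁿ`, as a quotient of `ℝⁿ⁺¹ ∖ {0}`. -/
noncomputable instance instTopologicalSpaceProjSpace (n : ℕ) : TopologicalSpace (ProjSpace n) :=
  TopologicalSpace.coinduced
    (Projectivization.mk' ℝ : {v : Fin (n + 1) → ℝ // v ≠ 0} → ProjSpace n) inferInstance

/-- For a nonzero linear form `φ`, the affine chart of `ℙⁿ` which is the complement of the
projective hyperplane `{φ = 0}`. -/
def affineChart {n : ℕ} (φ : Module.Dual ℝ (Fin (n + 1) → ℝ)) : Set (ProjSpace n) :=
  {p | φ p.rep ≠ 0}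

/-- The identification of the affine chart `affineChart φ` with the affine hyperplane `{φ = 1}`
of `ℝⁿ⁺¹`: a line is sent to its unique vector on which `φ` is `1`. It does not depend on the
representative `p.rep`. (The value is `0` outside of the chart.) -/
noncomputable def chartCoord {n : ℕ} (φ : Module.Dual ℝ (Fin (n + 1) → ℝ)) (p : ProjSpace n) :
    Fin (n + 1) → ℝ :=
  (φ p.rep)⁻¹ • p.rep

/-- `Ω` is contained in some affine chart, and is convex in this chart. -/
def IsConvex {n : ℕ} (Ω : Set (ProjSpace n)) : Prop :=
  ∃ φ : Module.Dual ℝ (Fin (n + 1) → ℝ),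
    φ ≠ 0 ∧ Ω ⊆ affineChart φ ∧ Convex ℝ (chartCoord φ '' Ω)

/-- A properly convex open set: a convex open subset of `ℙⁿ` whose closure is contained in some
affine chart. -/
structure IsProperlyConvexOpen {n : ℕ} (Ω : Set (ProjSpace n)) : Prop where
  isOpen : IsOpen Ω
  isConvex : IsConvex Ω
  closure_subset : ∃ φ : Module.Dual ℝ (Fin (n + 1) → ℝ), φ ≠ 0 ∧ closure Ω ⊆ affineChart φ

/-- The distance between two points of the affine chart `affineChart φ`, for the Euclidean norm
on this chart that is induced by the standard Euclidean norm of `ℝⁿ⁺¹`. -/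
noncomputable def chartDist {n : ℕ} (φ : Module.Dual ℝ (Fin (n + 1) → ℝ)) (p q : ProjSpace n) :
    ℝ :=
  ‖WithLp.toLp 2 (chartCoord φ p - chartCoord φ q)‖

/-- The cross-ratio `[a : b : x : y] = (|a - x| |b - y|) / (|a - y| |b - x|)`, computed in the
affine chart `affineChart φ`. -/
noncomputable def crossRatio {n : ℕ} (φ : Module.Dual ℝ (Fin (n + 1) → ℝ))
    (a b x y : ProjSpace n) : ℝ :=
  (chartDist φ a x * chartDist φ b y) / (chartDist φ a y * chartDist φ b x)

/-- `r = (1/2) ln [a : b : x : y]`, where, in some affine chart which contains the closure of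
`Ω`, the points `a, b` are the points of the boundary of `Ω` on the line `(xy)` such that `x` is
between `b` and `y`, and `y` is between `x` and `a`. -/
def IsHilbertDist {n : ℕ} (Ω : Set (ProjSpace n)) (x y : ProjSpace n) (r : ℝ) : Prop :=
  ∃ φ : Module.Dual ℝ (Fin (n + 1) → ℝ), φ ≠ 0 ∧ closure Ω ⊆ affineChart φ ∧
    ∃ a ∈ frontier Ω, ∃ b ∈ frontier Ω,
      Sbtw ℝ (chartCoord φ b) (chartCoord φ x) (chartCoord φ y) ∧
      Sbtw ℝ (chartCoord φ x) (chartCoord φ y) (chartCoord φ a) ∧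
      r = 1 / 2 * Real.log (crossRatio φ a b x y)

open Classical in
/-- The Hilbert distance `d_Ω` on a properly convex open set `Ω`. For distinct points `x, y` of
such an `Ω` there is exactly one `r` with `IsHilbertDist Ω x y r`; and `d_Ω(x, x) = 0`. -/
noncomputable def hilbertDist {n : ℕ} (Ω : Set (ProjSpace n)) (x y : ProjSpace n) : ℝ :=
  if h : x ≠ y ∧ ∃ r, IsHilbertDist Ω x y r then h.2.choose else 0

/-- `Aut(Ω)`: the subgroup of the elements of `SL_{n+1}(ℝ)` whose action on `ℙⁿ` preserves
`Ω`. -/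
noncomputable def Aut {n : ℕ} (Ω : Set (ProjSpace n)) : Subgroup SL(n + 1, ℝ) :=
  MulAction.stabilizer SL(n + 1, ℝ) Ω

/-- The subgroup `Γ_ε` of `Γ` generated by the elements `γ ∈ Γ` with `d_Ω(x, γ x) ≤ ε`. -/
noncomputable def smallSubgroup {n : ℕ} (Ω : Set (ProjSpace n)) (Γ : Subgroup SL(n + 1, ℝ))
    (x : ProjSpace n) (ε : ℝ) : Subgroup SL(n + 1, ℝ) :=
  Subgroup.closure {γ | γ ∈ Γ ∧ hilbertDist Ω x (γ • x) ≤ ε}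

end HilbertGeometry

/-!
Fix a point `x` of a properly convex open set `Ω`. The cone over `Ω` in `ℝⁿ⁺¹` is open, convex, and
its closure contains no line, so the vectors `v` with `-x ≤ v ≤ x` for the order of this cone form a
compact neighbourhood `B` of `0` (`orderBall`). The Hilbert distance is the distance attached to
this order: the cross-ratio of `x` and `y` is a product `s * t` with `y ≤ t • x` and `x ≤ s • y`
(`exists_order_of_mem`). An automorphism of `Ω` preserves the order up to sign; hence, if it moves
`x` by `d`, it maps `B` into `t • B` and its inverse maps `B` into `s • B`, where
`s * t = exp (2 * d)` (`dilatesBy_of_mem_aut`). This property is submultiplicative, so it replaces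
the triangle inequality for the Hilbert distance.

In the basis formed by vectors of `B` of maximal determinant, the vectors of `B` have coordinates at
most `1` (`exists_det_maximal`), so the matrix of such an automorphism has entries at most `t`. As
the determinant of the automorphism is `1`, both `s` and `t` are at least `1`, and `t` is at most
`exp (2 * d)`. This gives a bound that depends on nothing but `n` and `d`, without compactness of
the space of pointed properly convex sets up to projective transformations.

It remains to run the Margulis argument in the algebra of matrices
(`exists_isNilpotent_index_le`). The elements close to `1` generate a nilpotent subgroup of a
discrete group, since iterated commutators of them tend to `1`
(`isNilpotent_of_closure_eq_top_of_norm_sub_one_le`). Cover the ball of matrices in which the small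
automorphisms live by `m` small balls. Products of at most `m` automorphisms moving `x` by at most
`ε` still lie in this ball if `ε` is small compared with `1 / m`; so they represent at most `m`
cosets of this nilpotent subgroup, and then there are no other cosets
(`finite_and_natCard_le_of_ncard_pow_smul_le`).
-/

open scoped commutatorElement

/-! ### Groups generated by elements with trivial iterated commutators -/

/-- The set of `(k + 1)`-fold left-normed commutators `⁅…⁅⁅s₀, s₁⁆, s₂⁆…, sₖ⁆` of elements
of `S`. -/
def iteratedCommutators {G : Type*} [Group G] (S : Set G) : ℕ → Set G
  | 0 => S
  | k + 1 => {c | ∃ h ∈ iteratedCommutators S k, ∃ g ∈ S, c = ⁅h, g⁆}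

lemma commutatorElement_mem_of_closure_eq_top {G : Type*} [Group G] {S : Set G}
    (hS : Subgroup.closure S = ⊤) {N : Subgroup G} [N.Normal] {h : G}
    (hh : ∀ g ∈ S, ⁅h, g⁆ ∈ N) (y : G) : ⁅h, y⁆ ∈ N := by
  have hy : y ∈ Subgroup.closure S := hS ▸ Subgroup.mem_top y
  induction hy using Subgroup.closure_induction with
  | mem x hx => exact hh x hx
  | one => simp
  | mul x y _ _ hx hy =>
    have : ⁅h, x * y⁆ = ⁅h, x⁆ * (x * ⁅h, y⁆ * x⁻¹) := by
      simp only [commutatorElement_def]; group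
    rw [this]
    exact N.mul_mem hx (Subgroup.Normal.conj_mem inferInstance _ hy _)
  | inv x _ hx =>
    have : ⁅h, x⁻¹⁆ = x⁻¹ * ⁅h, x⁆⁻¹ * x⁻¹⁻¹ := by
      simp only [commutatorElement_def]; group
    rw [this]
    exact Subgroup.Normal.conj_mem inferInstance _ (N.inv_mem hx) _

/-- The iterated commutators climb down the upper central series: those of length `k + 1 - i` lie
in its `i`-th term, because an element whose commutators with all generators lie in a normal
subgroup is central modulo it. -/
lemma isNilpotent_of_iteratedCommutators_subset {G : Type*} [Group G] {S : Set G}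
    (hS : Subgroup.closure S = ⊤) {k : ℕ} (hk : iteratedCommutators S k ⊆ {1}) :
    Group.IsNilpotent G := by
  have key : ∀ i ≤ k, iteratedCommutators S (k - i) ⊆ Subgroup.upperCentralSeries G i := by
    intro i
    induction i with
    | zero => intro _ x hx; simpa using hk hx
    | succ i ih =>
      intro hi x hx
      change x ∈ Subgroup.upperCentralSeries G (i + 1)
      rw [Subgroup.mem_upperCentralSeries_succ_iff]
      intro y
      refine commutatorElement_mem_of_closure_eq_top hS (fun g hg => ?_) y
      apply ih (by omega)
      rw [show k - i = k - (i + 1) + 1 by omega]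
      exact ⟨x, hx, g, hg, rfl⟩
  refine ⟨k, ?_⟩
  rw [eq_top_iff, ← hS, Subgroup.closure_le]
  simpa using! key k le_rfl

/-! ### Zassenhaus neighbourhoods -/

section Zassenhaus

variable {A : Type*} [NormedRing A] [NormOneClass A] {G : Type*} [Group G]

/-- The commutator of two elements close to `1` is much closer to `1`, by the identity
`g * h - h * g = (g - 1) * (h - 1) - (h - 1) * (g - 1)`. -/
lemma norm_map_commutatorElement_sub_one_le (ρ : G →* A) {g h : G} {r s : ℝ} (hs : s ≤ 1 / 8)
    (hr : r ≤ 1 / 8) (hg : ‖ρ g - 1‖ ≤ s) (hg' : ‖ρ g⁻¹ - 1‖ ≤ s) (hh : ‖ρ h - 1‖ ≤ r)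
    (hh' : ‖ρ h⁻¹ - 1‖ ≤ r) : ‖ρ ⁅g, h⁆ - 1‖ ≤ 4 * (s * r) := by
  have e1 : ρ g * ρ g⁻¹ = 1 := by simp [← map_mul]
  have e2 : ρ h * ρ h⁻¹ = 1 := by simp [← map_mul]
  have key : ρ ⁅g, h⁆ - 1 =
      ((ρ g - 1) * (ρ h - 1) - (ρ h - 1) * (ρ g - 1)) * (ρ g⁻¹ * ρ h⁻¹) := by
    have e3 : ρ h * ρ g * (ρ g⁻¹ * ρ h⁻¹) = 1 := by
      rw [mul_assoc, ← mul_assoc (ρ g), e1, one_mul, e2]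
    have e4 : (ρ g - 1) * (ρ h - 1) - (ρ h - 1) * (ρ g - 1) = ρ g * ρ h - ρ h * ρ g := by
      noncomm_ring
    rw [e4, sub_mul, e3]
    simp [commutatorElement_def, mul_assoc]
  have bound (x : A) (hx : ‖x - 1‖ ≤ 1 / 8) : ‖x‖ ≤ 9 / 8 := by
    have := norm_add_le (x - 1) 1
    rw [sub_add_cancel, norm_one] at this
    linarith
  have hr0 : 0 ≤ r := (norm_nonneg _).trans hh
  have hs0 : 0 ≤ s := (norm_nonneg _).trans hg
  have h1 : ‖(ρ g - 1) * (ρ h - 1)‖ ≤ s * r :=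
    (norm_mul_le _ _).trans (mul_le_mul hg hh (norm_nonneg _) hs0)
  have h2 : ‖(ρ h - 1) * (ρ g - 1)‖ ≤ r * s :=
    (norm_mul_le _ _).trans (mul_le_mul hh hg (norm_nonneg _) hr0)
  have h3 : ‖ρ g⁻¹ * ρ h⁻¹‖ ≤ 9 / 8 * (9 / 8) :=
    (norm_mul_le _ _).trans (mul_le_mul (bound _ (hg'.trans hs)) (bound _ (hh'.trans hr))
      (norm_nonneg _) (by norm_num))
  have hsr : 0 ≤ s * r := mul_nonneg hs0 hr0
  rw [key]
  calc _ ≤ (s * r + r * s) * (9 / 8 * (9 / 8)) :=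
        (norm_mul_le _ _).trans (mul_le_mul ((norm_sub_le _ _).trans (add_le_add h1 h2)) h3
          (norm_nonneg _) (by rw [mul_comm r s]; positivity))
    _ ≤ 4 * (s * r) := by linarith

/-- **Zassenhaus**: a discrete group generated by elements close to `1` is nilpotent. -/
lemma isNilpotent_of_closure_eq_top_of_norm_sub_one_le (ρ : G →* A) {S : Set G}
    (hS : Subgroup.closure S = ⊤) (h1 : ∀ g ∈ S, ‖ρ g - 1‖ ≤ 1 / 8)
    (h2 : ∀ g ∈ S, ‖ρ g⁻¹ - 1‖ ≤ 1 / 8) {δ : ℝ} (hδ : 0 < δ)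
    (hdisc : ∀ g, ‖ρ g - 1‖ < δ → g = 1) : Group.IsNilpotent G := by
  have key (k : ℕ) : ∀ c ∈ iteratedCommutators S k,
      ‖ρ c - 1‖ ≤ 1 / 8 * (1 / 2) ^ k ∧ ‖ρ c⁻¹ - 1‖ ≤ 1 / 8 * (1 / 2) ^ k := by
    induction k with
    | zero => intro c hc; simpa using ⟨by simpa using h1 c hc, by simpa using h2 c hc⟩
    | succ k ih =>
      rintro c ⟨h, hh, g, hg, rfl⟩
      have hr : (1 / 8 * (1 / 2) ^ k : ℝ) ≤ 1 / 8 := by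
        have : ((1 / 2) ^ k : ℝ) ≤ 1 := pow_le_one₀ (by norm_num) (by norm_num)
        linarith
      obtain ⟨a, b⟩ := ih h hh
      have A1 := norm_map_commutatorElement_sub_one_le ρ hr le_rfl a b (h1 g hg) (h2 g hg)
      have A2 := norm_map_commutatorElement_sub_one_le ρ le_rfl hr (h1 g hg) (h2 g hg) a b
      rw [commutatorElement_inv, pow_succ]
      exact ⟨A1.trans_eq (by ring), A2.trans_eq (by ring)⟩
  obtain ⟨k, hk⟩ := exists_pow_lt_of_lt_one hδ (show (1 / 2 : ℝ) < 1 by norm_num)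
  refine isNilpotent_of_iteratedCommutators_subset hS (k := k) fun c hc => hdisc c ?_
  refine ((key k c hc).1).trans_lt (lt_of_le_of_lt ?_ hk)
  have : (0 : ℝ) < (1 / 2) ^ k := by positivity
  linarith


/-! ### The Margulis covering argument -/

/-- A transitive action whose orbit pieces `S ^ j • a` stay of size at most `m` for `j ≤ m` is an
action on at most `m` points: an increasing chain of `m + 1` such pieces stabilizes, and a piece
which does not grow under the generating set `S` is everything. -/
lemma finite_and_natCard_le_of_ncard_pow_smul_le {G X : Type*} [Group G] [MulAction G X]
    [MulAction.IsPretransitive G X] {S : Set G} (h1 : 1 ∈ S) (hinv : ∀ g ∈ S, g⁻¹ ∈ S)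
    (hS : Subgroup.closure S = ⊤) (a : X) {m : ℕ}
    (hfin : ∀ j ≤ m, ((· • a) '' (S ^ j : Set G)).Finite)
    (hcard : ∀ j ≤ m, ((· • a) '' (S ^ j : Set G)).ncard ≤ m) :
    Finite X ∧ Nat.card X ≤ m := by
  set Y : ℕ → Set X := fun j => (· • a) '' (S ^ j : Set G) with hY
  have hmono : Monotone Y := monotone_nat_of_le_succ fun j =>
    Set.image_mono (Set.pow_subset_pow_right h1 (Nat.le_succ j))
  obtain ⟨j, hj, hjY⟩ : ∃ j < m, Y (j + 1) = Y j := by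
    by_contra! hne
    have grow : ∀ j ≤ m, j + 1 ≤ (Y j).ncard := by
      intro j
      induction j with
      | zero => intro _; simp [hY]
      | succ j ih =>
        intro hj
        have hss : Y j ⊂ Y (j + 1) :=
          (hmono (Nat.le_succ j)).ssubset_of_ne (hne j (by omega)).symm
        have := Set.ncard_lt_ncard hss (hfin _ hj)
        have := ih (by omega)
        omega
    exact absurd (hcard m le_rfl) (not_le.mpr (grow m le_rfl))
  have hstep : ∀ g ∈ S, ∀ x ∈ Y j, g • x ∈ Y j := by
    rintro g hg _ ⟨w, hw, rfl⟩
    rw [← hjY]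
    exact ⟨g * w, by rw [pow_succ']; exact Set.mul_mem_mul hg hw, by simp [mul_smul]⟩
  have hall : ∀ g : G, ∀ x ∈ Y j, g • x ∈ Y j := by
    intro g
    have hg : g ∈ Subgroup.closure S := hS ▸ Subgroup.mem_top g
    induction hg using Subgroup.closure_induction'' with
    | mem x hx => exact hstep x hx
    | inv_mem x hx => exact hstep _ (hinv x hx)
    | one => intro x hx; simpa using hx
    | mul x y _ _ hx hy => intro z hz; rw [mul_smul]; exact hx _ (hy _ hz)
  have huniv : Y j = Set.univ := by
    refine Set.eq_univ_of_forall fun x => ?_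
    obtain ⟨g, rfl⟩ := MulAction.exists_smul_eq G a x
    exact hall g a (hmono (Nat.zero_le j) (by simp [hY]))
  have hf := hfin j hj.le
  have hc := hcard j hj.le
  change (Y j).Finite at hf
  change (Y j).ncard ≤ m at hc
  rw [huniv] at hf hc
  exact ⟨Set.finite_univ_iff.mp hf, by rwa [Set.ncard_univ] at hc⟩

lemma exists_finset_cover_closedBall {A : Type*} [PseudoMetricSpace A] [ProperSpace A]
    (a : A) (R : ℝ) {δ : ℝ} (hδ : 0 < δ) :
    ∃ t : Finset A, Metric.closedBall a R ⊆ ⋃ y ∈ t, Metric.ball y δ := by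
  obtain ⟨t, _, ht, hcov⟩ := (isCompact_closedBall a R).finite_cover_balls hδ
  exact ⟨ht.toFinset, by simpa using! hcov⟩

/-- **Margulis**: if the products of at most `m` generators of a discrete group stay in the ball of
radius `R` of a finite-dimensional normed algebra, where `m` is the number of small balls needed to
cover this ball, then the subgroup generated by the elements close to `1` is nilpotent, and it has
index at most `m`: among more than `m` cosets of it, two would have representatives in the same
small ball, and then the quotient of these representatives is close to `1`. -/
theorem exists_isNilpotent_index_le (A : Type*) [NormedRing A] [NormOneClass A] [ProperSpace A]
    (R : ℝ) :
    ∃ m : ℕ, ∀ {G : Type} [Group G] (ρ : G →* A) (S : Set G), 1 ∈ S → (∀ g ∈ S, g⁻¹ ∈ S) →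
      Subgroup.closure S = ⊤ → (∀ j ≤ m, ∀ g ∈ S ^ j, ‖ρ g‖ ≤ R ∧ ‖ρ g⁻¹‖ ≤ R) →
      (∃ δ > 0, ∀ g, ‖ρ g - 1‖ < δ → g = 1) →
      ∃ N : Subgroup G, Group.IsNilpotent N ∧ N.FiniteIndex ∧ N.index ≤ m := by
  -- If `ρ g` and `ρ h` lie in the same ball of radius `1 / (16 * R')`, then
  -- `ρ (g⁻¹ * h) - 1 = ρ g⁻¹ * (ρ h - ρ g)` has norm at most `R' / (8 * R') = 1 / 8`.
  set R' := max R 1 with hR'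
  have hR0 : 0 < R' := lt_max_of_lt_right one_pos
  obtain ⟨t, ht⟩ := exists_finset_cover_closedBall (0 : A) R' (δ := 1 / (16 * R')) (by positivity)
  refine ⟨t.card, fun {G} _ ρ S h1 hinv hS hR hdisc => ?_⟩
  obtain ⟨δ, hδ, hdisc⟩ := hdisc
  set U : Set G := {g | ‖ρ g - 1‖ ≤ 1 / 8 ∧ ‖ρ g⁻¹ - 1‖ ≤ 1 / 8} with hU
  set N := Subgroup.closure U with hN
  have hnil : Group.IsNilpotent N := by
    refine isNilpotent_of_closure_eq_top_of_norm_sub_one_le (ρ.comp N.subtype)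
      (S := ((↑) : N → G) ⁻¹' U) (Subgroup.closure_closure_coe_preimage) (fun g hg => hg.1)
      (fun g hg => hg.2) hδ fun g hg => Subtype.ext (hdisc g hg)
  have hclose : ∀ y, ∀ g h : G, ‖ρ g⁻¹‖ ≤ R → ‖ρ h⁻¹‖ ≤ R → ρ g ∈ Metric.ball y (1 / (16 * R')) →
      ρ h ∈ Metric.ball y (1 / (16 * R')) → g⁻¹ * h ∈ N := by
    have half : ∀ g h : G, ‖ρ g⁻¹‖ ≤ R → ‖ρ h - ρ g‖ ≤ 1 / (8 * R') →
        ‖ρ (g⁻¹ * h) - 1‖ ≤ 1 / 8 := by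
      intro g h hg hd
      have : ρ (g⁻¹ * h) - 1 = ρ g⁻¹ * (ρ h - ρ g) := by
        rw [mul_sub, ← map_mul, ← map_mul, inv_mul_cancel, map_one]
      rw [this]
      calc _ ≤ R' * (1 / (8 * R')) := (norm_mul_le _ _).trans
            (mul_le_mul (hg.trans (le_max_left _ _)) hd (norm_nonneg _) hR0.le)
        _ = 1 / 8 := by field_simp
    intro y g h hg hh hgy hhy
    have hd : ‖ρ h - ρ g‖ ≤ 1 / (8 * R') := by
      rw [← dist_eq_norm]
      have := dist_triangle_right (ρ h) (ρ g) y
      rw [Metric.mem_ball] at hgy hhy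
      have : 1 / (8 * R') = 1 / (16 * R') + 1 / (16 * R') := by field_simp; norm_num
      linarith
    refine Subgroup.subset_closure ⟨half g h hg hd, ?_⟩
    rw [mul_inv_rev, inv_inv]
    exact half h g hh (by rwa [norm_sub_rev])
  have hpiece : ∀ j ≤ t.card, ((· • ((1 : G) : G ⧸ N)) '' (S ^ j : Set G)).encard ≤ t.card := by
    intro j hj
    have hmem : ∀ x : (· • ((1 : G) : G ⧸ N)) '' (S ^ j : Set G), ∃ y : t, ∃ g ∈ S ^ j,
        ((g : G) : G ⧸ N) = x ∧ ρ g ∈ Metric.ball (y : A) (1 / (16 * R')) := by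
      rintro ⟨_, g, hg, rfl⟩
      have : ρ g ∈ Metric.closedBall (0 : A) R' := by
        rw [mem_closedBall_zero_iff]
        exact (hR j hj g hg).1.trans (le_max_left _ _)
      obtain ⟨y, hy, hgy⟩ := Set.mem_iUnion₂.mp (ht this)
      exact ⟨⟨y, hy⟩, g, hg, by simp, hgy⟩
    choose f hf using hmem
    have hinj : Function.Injective f := by
      intro x x' hxx
      obtain ⟨g, hg, hgx, hgf⟩ := hf x
      obtain ⟨h, hh, hhx, hhf⟩ := hf x'
      rw [← hxx] at hhf
      refine Subtype.ext ?_
      rw [← hgx, ← hhx, QuotientGroup.eq]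
      exact hclose _ g h (hR j hj g hg).2 (hR j hj h hh).2 hgf hhf
    simpa using! ENat.card_le_card_of_injective hinj
  obtain ⟨hfin, hcard⟩ := finite_and_natCard_le_of_ncard_pow_smul_le (m := t.card) h1 hinv hS
    ((1 : G) : G ⧸ N) (fun j hj => Set.finite_of_encard_le_coe (hpiece j hj))
    (fun j hj => by
      have := hpiece j hj
      rw [← (Set.finite_of_encard_le_coe this).cast_ncard_eq] at this
      exact_mod_cast this)
  exact ⟨N, hnil, Subgroup.finiteIndex_of_finite_quotient, hcard⟩

end Zassenhaus

/-! ### Bases of maximal determinant -/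

open Matrix in
/-- **Auerbach's lemma**: for a compact neighbourhood `B` of `0`, a matrix `P` with columns in `B` and of
maximal determinant is invertible, and all vectors of `B` have coordinates at most `1` in the basis
of its columns, by Cramer's rule. -/
lemma exists_det_maximal {ι : Type*} [Fintype ι] [DecidableEq ι] {B : Set (ι → ℝ)}
    (hB : IsCompact B) (h0 : B ∈ nhds 0) :
    ∃ P : Matrix ι ι ℝ, P.det ≠ 0 ∧ (∀ j, P.col j ∈ B) ∧
      (∀ v ∈ B, ∀ i, |(P⁻¹ *ᵥ v) i| ≤ 1) ∧
      ∀ Q : Matrix ι ι ℝ, (∀ j, Q.col j ∈ B) → |Q.det| ≤ |P.det| := by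
  have hcomp : IsCompact {P : Matrix ι ι ℝ | ∀ j, P.col j ∈ B} := by
    have := (isCompact_univ_pi (fun _ : ι => hB)).image
      (f := fun Q : ι → ι → ℝ => (Matrix.of Q)ᵀ) (by fun_prop)
    convert! this
    ext P
    constructor
    · intro hP
      exact ⟨Pᵀ, fun j _ => hP j, rfl⟩
    · rintro ⟨Q, hQ, rfl⟩ j
      exact hQ j trivial
  obtain ⟨r, hr, hrB⟩ : ∃ r : ℝ, r ≠ 0 ∧ ∀ j : ι, (r • (1 : Matrix ι ι ℝ)).col j ∈ B := by
    have ht : ∀ j : ι, Filter.Tendsto (fun r : ℝ => (r • (1 : Matrix ι ι ℝ)).col j)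
        (nhdsWithin 0 {0}ᶜ) (nhds 0) := by
      intro j
      have hc : Continuous fun r : ℝ => (r • (1 : Matrix ι ι ℝ)).col j := by
        refine continuous_pi fun i => ?_
        simp only [Matrix.col_apply, Matrix.smul_apply]
        fun_prop
      have := hc.tendsto 0
      have h00 : ((0 : ℝ) • (1 : Matrix ι ι ℝ)).col j = 0 := by ext; simp
      rw [h00] at this
      exact this.mono_left nhdsWithin_le_nhds
    have hev := (Filter.eventually_all.mpr fun j => (ht j).eventually h0).and
      self_mem_nhdsWithin
    obtain ⟨r, hr, hr'⟩ := hev.exists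
    exact ⟨r, hr', hr⟩
  obtain ⟨P, hPB, hmax⟩ := hcomp.exists_isMaxOn ⟨_, hrB⟩
    (f := fun P : Matrix ι ι ℝ => |P.det|) (by fun_prop)
  have hdet : P.det ≠ 0 := by
    have := hmax hrB
    simp only [Set.mem_ofPred_eq, Matrix.det_smul, Matrix.det_one, mul_one] at this
    exact abs_pos.mp (lt_of_lt_of_le (abs_pos.mpr (pow_ne_zero _ hr)) this)
  refine ⟨P, hdet, hPB, fun v hv i => ?_, fun Q hQ => hmax hQ⟩
  have hcr := Matrix.det_smul_inv_mulVec_eq_cramer P v hdet.isUnit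
  have hi := congrFun hcr i
  rw [Matrix.cramer_apply, Pi.smul_apply, smul_eq_mul] at hi
  have hle : |(P.updateCol i v).det| ≤ |P.det| := by
    refine hmax fun j => ?_
    by_cases hj : j = i
    · subst hj
      convert! hv
      ext k; simp
    · convert! hPB j using 1
      ext k; simp [hj]
  rw [← hi, abs_mul] at hle
  exact le_of_mul_le_mul_left (by linarith) (abs_pos.mpr hdet)

/-! ### Dilation of a body by a unimodular matrix -/

section Dilation

variable {n : ℕ}

open Matrix

/-- The matrix `γ` maps `B` into `t • B` and its inverse maps `B` into `s • B`, for some positive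
`s`, `t` whose product is at most `c`. -/
def DilatesBy (B : Set (Fin (n + 1) → ℝ)) (c : ℝ) (γ : SL(n + 1, ℝ)) : Prop :=
  ∃ s t : ℝ, 0 < s ∧ 0 < t ∧ s * t ≤ c ∧ (∀ v ∈ B, γ • v ∈ t • B) ∧ ∀ v ∈ B, γ⁻¹ • v ∈ s • B

variable {B : Set (Fin (n + 1) → ℝ)} {c d : ℝ} {γ η : SL(n + 1, ℝ)}

lemma DilatesBy.one : DilatesBy B 1 1 :=
  ⟨1, 1, one_pos, one_pos, by norm_num, fun v hv => by simpa, fun v hv => by simpa⟩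

lemma DilatesBy.mono (h : DilatesBy B c γ) (hcd : c ≤ d) : DilatesBy B d γ := by
  obtain ⟨s, t, hs, ht, hst, h⟩ := h
  exact ⟨s, t, hs, ht, hst.trans hcd, h⟩

lemma DilatesBy.inv (h : DilatesBy B c γ) : DilatesBy B c γ⁻¹ := by
  obtain ⟨s, t, hs, ht, hst, h1, h2⟩ := h
  exact ⟨t, s, ht, hs, by linarith, h2, by simpa using h1⟩

lemma DilatesBy.mul (h : DilatesBy B c γ) (h' : DilatesBy B d η) : DilatesBy B (c * d) (γ * η) := by
  obtain ⟨s, t, hs, ht, hst, h1, h2⟩ := h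
  obtain ⟨s', t', hs', ht', hst', h1', h2'⟩ := h'
  have comp : ∀ {γ η : SL(n + 1, ℝ)} {t t' : ℝ}, (∀ v ∈ B, γ • v ∈ t • B) →
      (∀ v ∈ B, η • v ∈ t' • B) → ∀ v ∈ B, (γ * η) • v ∈ (t' * t) • B := by
    intro γ η t t' h h' v hv
    obtain ⟨w, hw, hw'⟩ := h' v hv
    change t' • w = η • v at hw'
    rw [mul_smul γ η v, ← hw', smul_comm γ t' w, mul_smul]
    exact Set.smul_mem_smul_set (h w hw)
  refine ⟨s * s', t' * t, by positivity, by positivity, ?_, comp h1 h1', ?_⟩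
  · calc s * s' * (t' * t) = (s * t) * (s' * t') := by ring
      _ ≤ c * d := mul_le_mul hst hst' (by positivity) (by nlinarith [mul_pos hs ht])
  · rw [_root_.mul_inv_rev]
    exact comp h2' h2

lemma DilatesBy.of_mem_pow {S : Set SL(n + 1, ℝ)} (hS : ∀ γ ∈ S, DilatesBy B c γ) (j : ℕ) :
    ∀ γ ∈ S ^ j, DilatesBy B (c ^ j) γ := by
  induction j with
  | zero => intro γ hγ; rw [pow_zero] at hγ ⊢; rw [Set.mem_one.mp hγ]; exact .one
  | succ j ih =>
    intro γ hγ
    rw [pow_succ] at hγ ⊢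
    obtain ⟨a, ha, b, hb, rfl⟩ := Set.mem_mul.mp hγ
    exact (ih a ha).mul (hS b hb)

/-- A matrix of determinant `1` cannot shrink `B`: it would also shrink the maximal determinant of
a matrix with columns in `B`. -/
lemma one_le_of_smul_mem {P : Matrix (Fin (n + 1)) (Fin (n + 1)) ℝ} (hP : P.det ≠ 0)
    (hPB : ∀ j, P.col j ∈ B)
    (hmax : ∀ Q : Matrix (Fin (n + 1)) (Fin (n + 1)) ℝ, (∀ j, Q.col j ∈ B) → |Q.det| ≤ |P.det|)
    {t : ℝ} (ht : 0 < t) (hγ : ∀ v ∈ B, γ • v ∈ t • B) : 1 ≤ t := by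
  have hcol : ∀ j, (t⁻¹ • (γ.1 * P)).col j ∈ B := by
    intro j
    have := hγ _ (hPB j)
    rw [Set.mem_smul_set_iff_inv_smul_mem₀ ht.ne'] at this
    convert! this using 1
  have := hmax _ hcol
  rw [det_smul, det_mul, γ.2, one_mul, abs_mul] at this
  have h1 : |t⁻¹ ^ Fintype.card (Fin (n + 1))| ≤ 1 := by
    by_contra! h
    nlinarith [abs_pos.mpr hP]
  rw [abs_of_pos (by positivity), inv_pow] at h1
  rw [← one_le_pow_iff_of_nonneg ht.le (n := Fintype.card (Fin (n + 1))) (by simp)]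
  exact (inv_le_one₀ (by positivity)).mp h1

attribute [local instance] Matrix.linftyOpNormedRing Matrix.linftyOpNormedAlgebra

lemma norm_conj_le {P : Matrix (Fin (n + 1)) (Fin (n + 1)) ℝ}
    (hPB : ∀ j, P.col j ∈ B) (hcoord : ∀ v ∈ B, ∀ i, |(P⁻¹ *ᵥ v) i| ≤ 1)
    {t : ℝ} (ht : 0 < t) (hγ : ∀ v ∈ B, γ • v ∈ t • B) :
    ‖P⁻¹ * γ.1 * P‖ ≤ (n + 1) * t := by
  have hentry : ∀ i j, |(P⁻¹ * γ.1 * P) i j| ≤ t := by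
    intro i j
    obtain ⟨w, hw, hw'⟩ := hγ _ (hPB j)
    change t • w = γ.1 *ᵥ P.col j at hw'
    have : (P⁻¹ * γ.1 * P) i j = t * (P⁻¹ *ᵥ w) i := by
      have h2 : t * (P⁻¹ *ᵥ w) i = (P⁻¹ *ᵥ (t • w)) i := by
        rw [mulVec_smul, Pi.smul_apply, smul_eq_mul]
      rw [h2, hw', mul_assoc]
      rfl
    rw [this, abs_mul, abs_of_pos ht]
    exact mul_le_of_le_one_right ht.le (hcoord w hw i)
  have h0 : 0 ≤ (n + 1) * t := by positivity
  rw [Matrix.linfty_opNorm_def, ← Real.coe_toNNReal _ h0, NNReal.coe_le_coe]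
  refine Finset.sup_le fun i _ => ?_
  rw [← NNReal.coe_le_coe, Real.coe_toNNReal _ h0, NNReal.coe_sum]
  calc ∑ j, ((‖(P⁻¹ * γ.1 * P) i j‖₊ : NNReal) : ℝ) ≤ ∑ _j : Fin (n + 1), t :=
        Finset.sum_le_sum fun j _ => by simpa using hentry i j
    _ = (n + 1) * t := by simp

/-- The matrices of the elements of `G` in the basis of the columns of `P`. -/
noncomputable def conjHom (G : Subgroup SL(n + 1, ℝ)) (P : Matrix (Fin (n + 1)) (Fin (n + 1)) ℝ)
    (hP : P.det ≠ 0) : G →* Matrix (Fin (n + 1)) (Fin (n + 1)) ℝ where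
  toFun g := P⁻¹ * g.1.1 * P
  map_one' := by simp [Matrix.nonsing_inv_mul P hP.isUnit]
  map_mul' g h := by
    have : P * P⁻¹ = 1 := Matrix.mul_nonsing_inv P hP.isUnit
    calc P⁻¹ * (g.1.1 * h.1.1) * P = P⁻¹ * g.1.1 * 1 * h.1.1 * P := by noncomm_ring
      _ = _ := by rw [← this]; noncomm_ring

lemma exists_pos_eq_one_of_norm_conjHom_sub_one_lt (G : Subgroup SL(n + 1, ℝ))
    [DiscreteTopology G] {P : Matrix (Fin (n + 1)) (Fin (n + 1)) ℝ} (hP : P.det ≠ 0) :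
    ∃ δ > 0, ∀ g, ‖conjHom G P hP g - 1‖ < δ → g = 1 := by
  have hPP : P * P⁻¹ = 1 := Matrix.mul_nonsing_inv P hP.isUnit
  have hopen : ({1} : Set G) ∈ nhds (1 : G) := (isOpen_discrete {1}).mem_nhds rfl
  have hind : Topology.IsInducing fun g : G => g.1.1 :=
    Topology.IsInducing.subtypeVal.comp Topology.IsInducing.subtypeVal
  rw [hind.nhds_eq_comap, Filter.mem_comap] at hopen
  obtain ⟨V, hV, hVG⟩ := hopen
  have hc : Filter.Tendsto (fun M : Matrix (Fin (n + 1)) (Fin (n + 1)) ℝ => P * M * P⁻¹)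
      (nhds 1) (nhds 1) := by
    have : Continuous (fun M : Matrix (Fin (n + 1)) (Fin (n + 1)) ℝ => P * M * P⁻¹) := by
      fun_prop
    simpa [hPP] using this.tendsto 1
  obtain ⟨δ, hδ, hball⟩ := Metric.mem_nhds_iff.mp (hc hV)
  refine ⟨δ, hδ, fun g hg => ?_⟩
  have hmem : conjHom G P hP g ∈ Metric.ball 1 δ := by rwa [mem_ball_iff_norm]
  have : P * conjHom G P hP g * P⁻¹ ∈ V := hball hmem
  have he : P * conjHom G P hP g * P⁻¹ = g.1.1 := by
    change P * (P⁻¹ * g.1.1 * P) * P⁻¹ = _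
    calc _ = P * P⁻¹ * g.1.1 * (P * P⁻¹) := by noncomm_ring
      _ = _ := by rw [hPP]; simp
  rw [he] at this
  exact hVG this

/-- The Margulis argument for a discrete group of matrices generated by elements that dilate some
compact neighbourhood of `0` only slightly. The constants do not depend on the neighbourhood, because
in a basis of maximal determinant these elements have uniformly bounded entries. -/
theorem exists_isNilpotent_index_le_of_dilatesBy (n : ℕ) :
    ∃ ε : ℝ, 0 < ε ∧ ∃ m : ℕ, ∀ G : Subgroup SL(n + 1, ℝ), DiscreteTopology G →
      ∀ B : Set (Fin (n + 1) → ℝ), IsCompact B → B ∈ nhds 0 →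
      ∀ S : Set SL(n + 1, ℝ), Subgroup.closure S = G →
      (∀ γ ∈ S, DilatesBy B (Real.exp (2 * ε)) γ) →
      ∃ N : Subgroup G, Group.IsNilpotent N ∧ N.FiniteIndex ∧ N.index ≤ m := by
  have : NormOneClass (Matrix (Fin (n + 1)) (Fin (n + 1)) ℝ) := Matrix.linfty_opNormOneClass
  have : ProperSpace (Matrix (Fin (n + 1)) (Fin (n + 1)) ℝ) := FiniteDimensional.proper ℝ _
  obtain ⟨m, hm⟩ := exists_isNilpotent_index_le (Matrix (Fin (n + 1)) (Fin (n + 1)) ℝ)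
    ((n + 1) * Real.exp 1)
  -- This `ε` ensures that the products of `m` elements dilate by at most `exp (2 * ε) ^ m ≤ exp 1`.
  have hε : (0 : ℝ) < 1 / (2 * (m + 1)) := by positivity
  refine ⟨1 / (2 * (m + 1)), hε, m, fun G hG B hB h0 S hS hdil => ?_⟩
  set c := Real.exp (2 * (1 / (2 * (m + 1)))) with hc
  have hc1 : 1 ≤ c := Real.one_le_exp (by positivity)
  have hcm : ∀ j ≤ m, c ^ j ≤ Real.exp 1 := by
    intro j hj
    rw [hc, ← Real.exp_nat_mul]
    apply Real.exp_le_exp.mpr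
    have : (j : ℝ) ≤ m := by exact_mod_cast hj
    have hm0 : (0 : ℝ) < m + 1 := by positivity
    rw [show (j : ℝ) * (2 * (1 / (2 * (m + 1)))) = j / (m + 1) by field_simp, div_le_one hm0]
    linarith
  obtain ⟨P, hP, hPB, hcoord, hmax⟩ := exists_det_maximal hB h0
  -- The products are bounded as soon as the dilation factor is: both factors are at least `1`.
  have hbound : ∀ g : SL(n + 1, ℝ), DilatesBy B (Real.exp 1) g →
      ‖P⁻¹ * g.1 * P‖ ≤ (n + 1) * Real.exp 1 := by
    rintro g ⟨s, t, hs, ht, hst, h1, h2⟩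
    refine (norm_conj_le hPB hcoord ht h1).trans ?_
    have := one_le_of_smul_mem hP hPB hmax hs h2
    have : t ≤ Real.exp 1 := by nlinarith
    gcongr
  refine hm (conjHom G P hP) {g : G | DilatesBy B c g} ?_ ?_ ?_ ?_
    (exists_pos_eq_one_of_norm_conjHom_sub_one_lt G hP)
  · exact DilatesBy.one.mono hc1
  · exact fun g hg => hg.inv
  · subst hS
    refine eq_top_iff.mpr ((Subgroup.closure_closure_coe_preimage (k := S)).symm.le.trans ?_)
    exact Subgroup.closure_mono fun g hg => hdil g hg
  · intro j hj g hg
    have hg' : (g : SL(n + 1, ℝ)) ∈ (((↑) : G → SL(n + 1, ℝ)) '' {g | DilatesBy B c g}) ^ j := by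
      have := Set.image_pow (f := G.subtype) {g : G | DilatesBy B c g} j
      simp only [Subgroup.coe_subtype] at this
      rw [← this]
      exact ⟨g, hg, rfl⟩
    have hgd : DilatesBy B (Real.exp 1) (g : SL(n + 1, ℝ)) :=
      (DilatesBy.of_mem_pow (by rintro _ ⟨x, hx, rfl⟩; exact hx) j _ hg').mono (hcm j hj)
    exact ⟨hbound _ hgd, hbound _ hgd.inv⟩

end Dilation

/-! ### The order ball of an open convex cone -/

section OrderBall

variable {V : Type*} [NormedAddCommGroup V]

/-- The unit ball of the order unit norm of the point `x`, for the order of the closed cone `K`: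
the vectors `v` with `-x ≤ v ≤ x`. -/
def orderBall (K : Set V) (x : V) : Set V := {v | x + v ∈ K ∧ x - v ∈ K}

lemma orderBall_mem_nhds {C : Set V} (hC : IsOpen C) {x : V} (hx : x ∈ C) :
    orderBall (closure C) x ∈ nhds 0 := by
  have h1 : ∀ᶠ v in nhds (0 : V), x + v ∈ C :=
    (Continuous.tendsto (by fun_prop : Continuous fun v => x + v) 0).eventually
      (hC.mem_nhds (by simpa using hx))
  have h2 : ∀ᶠ v in nhds (0 : V), x - v ∈ C :=
    (Continuous.tendsto (by fun_prop : Continuous fun v => x - v) 0).eventually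
      (hC.mem_nhds (by simpa using hx))
  filter_upwards [h1, h2] with v hv hv'
  exact ⟨subset_closure hv, subset_closure hv'⟩

variable [NormedSpace ℝ V]

/-- `C` is a convex cone: it is stable under addition and under multiplication by positive
scalars. -/
structure IsConvexCone (C : Set V) : Prop where
  add_mem : ∀ v ∈ C, ∀ w ∈ C, v + w ∈ C
  smul_mem : ∀ c : ℝ, 0 < c → ∀ v ∈ C, c • v ∈ C

lemma IsConvexCone.closure {C : Set V} (hC : IsConvexCone C) : IsConvexCone (closure C) where
  add_mem _ hv _ hw := map_mem_closure₂ continuous_add hv hw hC.add_mem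
  smul_mem c hc _ hv := map_mem_closure (continuous_const_smul c) hv (hC.smul_mem c hc)

lemma IsConvexCone.neg {C : Set V} (hC : IsConvexCone C) : IsConvexCone (-C) where
  add_mem v hv w hw := by
    rw [Set.mem_neg] at *
    rw [neg_add]
    exact hC.add_mem _ hv _ hw
  smul_mem c hc v hv := by
    rw [Set.mem_neg] at *
    rw [← smul_neg]
    exact hC.smul_mem c hc _ hv

lemma IsConvexCone.zero_mem_closure {C : Set V} (hC : IsConvexCone C) {x : V} (hx : x ∈ C) :
    0 ∈ _root_.closure C := by
  have ht : Filter.Tendsto (fun c : ℝ => c • x) (nhdsWithin 0 (Set.Ioi 0)) (nhds 0) := by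
    have : Continuous fun c : ℝ => c • x := by fun_prop
    have := this.tendsto 0
    rw [zero_smul] at this
    exact this.mono_left nhdsWithin_le_nhds
  exact mem_closure_of_tendsto ht (Filter.eventually_of_mem self_mem_nhdsWithin
    fun c hc => hC.smul_mem c hc x hx)

lemma IsConvexCone.pos_or_neg {C : Set V} (hC : IsConvexCone C) (f : Module.Dual ℝ V)
    (hf : ∀ v ∈ C, f v ≠ 0) : (∀ v ∈ C, 0 < f v) ∨ ∀ v ∈ C, f v < 0 := by
  by_contra! h
  obtain ⟨⟨v, hv, hv'⟩, w, hw, hw'⟩ := h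
  have hv0 := lt_of_le_of_ne hv' (hf v hv)
  have hw0 := lt_of_le_of_ne hw' (hf w hw).symm
  refine hf _ (hC.add_mem _ (hC.smul_mem _ hw0 v hv) _ (hC.smul_mem _ (neg_pos.mpr hv0) w hw)) ?_
  simp only [map_add, map_smul, smul_eq_mul]
  ring

/-- A ray that starts in a proper open cone, in a direction where the form `f` is constant, leaves
it: the last point of the closed cone on this ray is a boundary point. -/
lemma exists_mem_closure_notMem_of_ray {C : Set V} (hC : IsOpen C) (f : Module.Dual ℝ V) {c : ℝ}
    (hc : 0 < c) (hf : ∀ v ∈ closure C, c * ‖v‖ ≤ f v) {x y : V} (hy : y ∈ C)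
    (hxy : x ≠ y) (hfxy : f x = f y) :
    ∃ τ : ℝ, 1 < τ ∧ x + τ • (y - x) ∈ closure C ∧ x + τ • (y - x) ∉ C := by
  have hcont : Continuous fun τ : ℝ => x + τ • (y - x) := by fun_prop
  have hcomp : IsCompact {τ : ℝ | 1 ≤ τ ∧ x + τ • (y - x) ∈ closure C} := by
    refine Metric.isCompact_of_isClosed_isBounded
      (isClosed_Ici.inter (isClosed_closure.preimage hcont)) ?_
    have hn : 0 < ‖y - x‖ := norm_pos_iff.mpr (sub_ne_zero.mpr hxy.symm)
    refine (Metric.isBounded_Icc 1 ((f x / c + ‖x‖) / ‖y - x‖)).subset fun τ hτ => ⟨hτ.1, ?_⟩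
    have h1 := hf _ hτ.2
    rw [map_add, map_smul, map_sub, hfxy, sub_self, smul_zero, add_zero] at h1
    have h2 : ‖x + τ • (y - x)‖ ≤ f x / c := by rw [le_div_iff₀ hc, hfxy]; linarith
    have h3 : ‖τ • (y - x)‖ ≤ ‖x + τ • (y - x)‖ + ‖x‖ := by
      simpa using norm_sub_le (x + τ • (y - x)) x
    rw [norm_smul, Real.norm_eq_abs, abs_of_nonneg (zero_le_one.trans hτ.1)] at h3
    rw [le_div_iff₀ hn]
    linarith
  have h1 : x + (1 : ℝ) • (y - x) = y := by simp
  obtain ⟨τ, hτ, hmax⟩ := hcomp.exists_isGreatest ⟨1, le_rfl, by rw [h1]; exact subset_closure hy⟩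
  have hnot : x + τ • (y - x) ∉ C := by
    intro hin
    have hev : ∀ᶠ σ in nhdsWithin τ (Set.Ioi τ), x + σ • (y - x) ∈ C :=
      ((hcont.tendsto τ).mono_left nhdsWithin_le_nhds).eventually (hC.mem_nhds hin)
    obtain ⟨σ, hσ, hσ'⟩ := (hev.and self_mem_nhdsWithin).exists
    exact absurd (hmax ⟨hτ.1.trans (le_of_lt hσ'), subset_closure hσ⟩) (not_le.mpr hσ')
  refine ⟨τ, lt_of_le_of_ne hτ.1 ?_, hτ.2, hnot⟩
  rintro rfl
  exact hnot (by rwa [h1])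

variable [FiniteDimensional ℝ V]

lemma exists_pos_mul_norm_le {C : Set V} (hC : IsConvexCone C) (f : Module.Dual ℝ V)
    (hf : ∀ v ∈ closure C, v ≠ 0 → 0 < f v) : ∃ c > 0, ∀ v ∈ closure C, c * ‖v‖ ≤ f v := by
  have : ProperSpace V := FiniteDimensional.proper ℝ V
  have hcomp : IsCompact (Metric.sphere (0 : V) 1 ∩ closure C) :=
    (isCompact_sphere _ _).inter_right isClosed_closure
  obtain ⟨c, hc, hmin⟩ : ∃ c > 0, ∀ u ∈ Metric.sphere (0 : V) 1 ∩ closure C, c ≤ f u := by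
    rcases (Metric.sphere (0 : V) 1 ∩ closure C).eq_empty_or_nonempty with he | hne
    · exact ⟨1, one_pos, by simp [he]⟩
    · obtain ⟨u, hu, hmin⟩ := hcomp.exists_isMinOn hne
        (LinearMap.continuous_of_finiteDimensional f).continuousOn
      exact ⟨f u, hf u hu.2 (ne_zero_of_mem_unit_sphere (⟨u, hu.1⟩ : Metric.sphere (0 : V) 1)),
        fun w hw => hmin hw⟩
  refine ⟨c, hc, fun v hv => ?_⟩
  rcases eq_or_ne v 0 with rfl | h0
  · simp
  have hn : 0 < ‖v‖ := norm_pos_iff.mpr h0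
  have := hmin (‖v‖⁻¹ • v) ⟨by simp [norm_smul, hn.ne'], hC.closure.smul_mem _ (by positivity) v hv⟩
  rw [map_smul, smul_eq_mul, inv_mul_eq_div, le_div_iff₀ hn] at this
  exact this

lemma isCompact_orderBall {C : Set V} (f : Module.Dual ℝ V) {c : ℝ} (hc : 0 < c)
    (hf : ∀ v ∈ closure C, c * ‖v‖ ≤ f v) (x : V) : IsCompact (orderBall (closure C) x) := by
  have : ProperSpace V := FiniteDimensional.proper ℝ V
  refine Metric.isCompact_of_isClosed_isBounded ?_ ?_
  · exact (isClosed_closure.preimage (by fun_prop : Continuous fun v => x + v)).inter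
      (isClosed_closure.preimage (by fun_prop : Continuous fun v => x - v))
  · refine (Metric.isBounded_iff_subset_closedBall 0).mpr ⟨2 * f x / c + ‖x‖, fun v hv => ?_⟩
    have h1 := hf _ hv.1
    have h2 := hf _ hv.2
    rw [map_add] at h1
    rw [map_sub] at h2
    have h3 : 0 ≤ c * ‖x - v‖ := by positivity
    have h4 : ‖x + v‖ ≤ 2 * f x / c := by
      rw [le_div_iff₀ hc]; linarith
    have h5 : ‖v‖ ≤ ‖x + v‖ + ‖x‖ := by simpa using norm_sub_le (x + v) x
    rw [mem_closedBall_zero_iff]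
    linarith

end OrderBall

lemma smul_mem_smul_orderBall {n : ℕ} {K : Set (Fin (n + 1) → ℝ)} (hK : IsConvexCone K)
    {γ : SL(n + 1, ℝ)} {σ : ℝ} (hσ : σ = 1 ∨ σ = -1) (hγ : ∀ v ∈ K, σ • γ • v ∈ K)
    {x : Fin (n + 1) → ℝ} {t : ℝ} (ht : 0 < t) (hx : t • x - σ • γ • x ∈ K) :
    ∀ v ∈ orderBall K x, γ • v ∈ t • orderBall K x := by
  have half : ∀ v ∈ orderBall K x, x + t⁻¹ • σ • γ • v ∈ K ∧ x - t⁻¹ • σ • γ • v ∈ K := by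
    rintro v ⟨h1, h2⟩
    have h1' := hK.smul_mem t⁻¹ (by positivity) _ (hK.add_mem _ hx _ (hγ _ h1))
    have h2' := hK.smul_mem t⁻¹ (by positivity) _ (hK.add_mem _ hx _ (hγ _ h2))
    have e : t⁻¹ • t • x = x := inv_smul_smul₀ ht.ne' x
    constructor
    · convert! h1' using 1
      rw [smul_add γ, smul_add σ, smul_add, smul_sub, e, smul_add]
      abel
    · convert! h2' using 1
      rw [smul_sub γ, smul_sub σ, smul_add, smul_sub, e, smul_sub]
      abel
  intro v hv
  rw [Set.mem_smul_set_iff_inv_smul_mem₀ ht.ne']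
  obtain ⟨h1, h2⟩ := half v hv
  rcases hσ with rfl | rfl
  · simp only [one_smul] at h1 h2
    exact ⟨h1, h2⟩
  · simp only [neg_smul, one_smul, smul_neg, sub_neg_eq_add] at h1 h2
    exact ⟨h2, by rwa [sub_eq_add_neg]⟩

namespace HilbertGeometry

variable {n : ℕ} {Ω : Set (ProjSpace n)}

/-! ### The cone over a properly convex open set -/

/-- The union of the lines of `Ω`, without the origin. -/
def doubleCone (Ω : Set (ProjSpace n)) : Set (Fin (n + 1) → ℝ) :=
  {v | ∃ h : v ≠ 0, Projectivization.mk ℝ v h ∈ Ω}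

/-- The half of the cone over `Ω` on which `φ` is positive. -/
def posCone (Ω : Set (ProjSpace n)) (φ : Module.Dual ℝ (Fin (n + 1) → ℝ)) :
    Set (Fin (n + 1) → ℝ) :=
  {v | v ∈ doubleCone Ω ∧ 0 < φ v}

variable {φ ψ : Module.Dual ℝ (Fin (n + 1) → ℝ)}

lemma smul_mem_doubleCone {v : Fin (n + 1) → ℝ} (hv : v ∈ doubleCone Ω) {c : ℝ} (hc : c ≠ 0) :
    c • v ∈ doubleCone Ω := by
  obtain ⟨h, hv⟩ := hv
  refine ⟨smul_ne_zero hc h, ?_⟩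
  rwa [(Projectivization.mk_eq_mk_iff' ℝ (c • v) v (smul_ne_zero hc h) h).mpr ⟨c, rfl⟩]

lemma mk_eq_of_smul {v w : Fin (n + 1) → ℝ} (hv : v ≠ 0) (hw : w ≠ 0)
    (h : Projectivization.mk ℝ v hv = Projectivization.mk ℝ w hw) : ∃ c : ℝ, c ≠ 0 ∧ v = c • w := by
  obtain ⟨c, hc⟩ := (Projectivization.mk_eq_mk_iff' ℝ v w hv hw).mp h
  exact ⟨c, by rintro rfl; exact hv (by rw [← hc, zero_smul]), hc.symm⟩

lemma continuous_mk' :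
    Continuous (Projectivization.mk' ℝ : {v : Fin (n + 1) → ℝ // v ≠ 0} → ProjSpace n) :=
  continuous_coinduced_rng

lemma isOpen_doubleCone (hΩ : IsOpen Ω) : IsOpen (doubleCone Ω) := by
  have h1 := (isOpen_compl_singleton (x := (0 : Fin (n + 1) → ℝ))).isOpenMap_subtype_val _
    (hΩ.preimage continuous_mk')
  convert! h1
  ext v
  constructor
  · rintro ⟨h, hv⟩
    exact ⟨⟨v, h⟩, hv, rfl⟩
  · rintro ⟨⟨w, h⟩, hw, rfl⟩
    exact ⟨h, hw⟩

lemma mem_doubleCone_closure {v : Fin (n + 1) → ℝ} (hv : v ∈ closure (doubleCone Ω)) (h0 : v ≠ 0) :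
    v ∈ doubleCone (closure Ω) := by
  by_contra hnot
  have hopen := isOpen_doubleCone (isClosed_closure (s := Ω)).isOpen_compl
  have hv' : v ∈ doubleCone (closure Ω)ᶜ := ⟨h0, fun h => hnot ⟨h0, h⟩⟩
  obtain ⟨w, ⟨hw0, hw⟩, _, hw'⟩ := mem_closure_iff.mp hv _ hopen hv'
  exact hw (subset_closure hw')

lemma mem_closure_doubleCone {v : Fin (n + 1) → ℝ} (hv : v ∈ doubleCone (closure Ω)) :
    v ∈ closure (doubleCone Ω) := by
  obtain ⟨h0, hv⟩ := hv
  by_contra hnot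
  -- The complement of `closure (doubleCone Ω)` is a union of lines, so its image is open.
  have hsmul : ∀ c : ℝ, c ≠ 0 → ∀ w ∈ closure (doubleCone Ω), c • w ∈ closure (doubleCone Ω) :=
    fun c hc w hw => map_mem_closure (continuous_const_smul c) hw
      fun u hu => smul_mem_doubleCone hu hc
  set W : Set (ProjSpace n) := {p | p.rep ∉ closure (doubleCone Ω)} with hW
  have hiff : ∀ w : Fin (n + 1) → ℝ, ∀ h : w ≠ 0,
      Projectivization.mk ℝ w h ∈ W ↔ w ∉ closure (doubleCone Ω) := by
    intro w h
    have hrep := Projectivization.mk_rep (Projectivization.mk ℝ w h)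
    obtain ⟨c, hc, hcw⟩ := mk_eq_of_smul _ h hrep
    rw [hW, Set.mem_ofPred_eq, hcw, not_iff_not]
    refine ⟨fun h' => ?_, hsmul c hc w⟩
    simpa [smul_smul, inv_mul_cancel₀ hc] using hsmul c⁻¹ (inv_ne_zero hc) _ h'
  have hWopen : IsOpen W := by
    rw [isOpen_coinduced]
    have : (Projectivization.mk' ℝ : {v : Fin (n + 1) → ℝ // v ≠ 0} → ProjSpace n) ⁻¹' W =
        (↑) ⁻¹' (closure (doubleCone Ω))ᶜ := by
      ext ⟨w, h⟩
      exact hiff w h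
    rw [this]
    exact isClosed_closure.isOpen_compl.preimage continuous_subtype_val
  obtain ⟨p, hpW, hpΩ⟩ := mem_closure_iff.mp hv W hWopen ((hiff v h0).mpr hnot)
  exact hpW (subset_closure ⟨p.rep_nonzero, by rwa [Projectivization.mk_rep]⟩)

lemma apply_ne_zero_of_mem_doubleCone (hφ : Ω ⊆ affineChart φ) {v : Fin (n + 1) → ℝ}
    (hv : v ∈ doubleCone Ω) : φ v ≠ 0 := by
  obtain ⟨h, hv⟩ := hv
  obtain ⟨c, hc, hcv⟩ := mk_eq_of_smul _ h (Projectivization.mk_rep (Projectivization.mk ℝ v h))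
  have := hφ hv
  rw [affineChart, Set.mem_ofPred_eq, hcv, map_smul] at this
  exact right_ne_zero_of_mul this

lemma chartCoord_mk {v : Fin (n + 1) → ℝ} (h : v ≠ 0) :
    chartCoord φ (Projectivization.mk ℝ v h) = (φ v)⁻¹ • v := by
  obtain ⟨c, hc, hcv⟩ := mk_eq_of_smul _ h (Projectivization.mk_rep (Projectivization.mk ℝ v h))
  rw [chartCoord, hcv, map_smul, smul_smul, smul_eq_mul, mul_inv, mul_right_comm,
    inv_mul_cancel₀ hc, one_mul]

lemma apply_chartCoord {p : ProjSpace n} (hp : p ∈ affineChart φ) : φ (chartCoord φ p) = 1 := by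
  rw [chartCoord, map_smul, smul_eq_mul, inv_mul_cancel₀ hp]

lemma chartCoord_ne_zero {p : ProjSpace n} (hp : p ∈ affineChart φ) : chartCoord φ p ≠ 0 :=
  smul_ne_zero (inv_ne_zero hp) p.rep_nonzero

lemma mk_chartCoord {p : ProjSpace n} (hp : p ∈ affineChart φ) :
    Projectivization.mk ℝ (chartCoord φ p) (chartCoord_ne_zero hp) = p := by
  conv_rhs => rw [← Projectivization.mk_rep p]
  exact (Projectivization.mk_eq_mk_iff' ℝ _ _ _ _).mpr ⟨_, rfl⟩

lemma chartCoord_mem_posCone {p : ProjSpace n} (hp : p ∈ affineChart φ) (hpΩ : p ∈ Ω) :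
    chartCoord φ p ∈ posCone Ω φ :=
  ⟨⟨chartCoord_ne_zero hp, by rwa [mk_chartCoord hp]⟩, by rw [apply_chartCoord hp]; exact one_pos⟩

lemma isOpen_posCone (hΩ : IsOpen Ω) (φ : Module.Dual ℝ (Fin (n + 1) → ℝ)) :
    IsOpen (posCone Ω φ) :=
  (isOpen_doubleCone hΩ).inter
    (isOpen_Ioi.preimage (LinearMap.continuous_of_finiteDimensional φ))

lemma posCone_smul_mem {c : ℝ} (hc : 0 < c) {v : Fin (n + 1) → ℝ} (hv : v ∈ posCone Ω φ) :
    c • v ∈ posCone Ω φ :=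
  ⟨smul_mem_doubleCone hv.1 hc.ne', by rw [map_smul]; exact mul_pos hc hv.2⟩

lemma isConvexCone_posCone_of_convex (hφ : Ω ⊆ affineChart φ)
    (hconv : Convex ℝ (chartCoord φ '' Ω)) : IsConvexCone (posCone Ω φ) where
  smul_mem _ hc _ hv := posCone_smul_mem hc hv
  add_mem v hv w hw := by
    have hadd : 0 < φ v + φ w := add_pos hv.2 hw.2
    have hK : ∀ u ∈ posCone Ω φ, (φ u)⁻¹ • u ∈ chartCoord φ '' Ω :=
      fun u hu => ⟨_, hu.1.2, chartCoord_mk hu.1.1⟩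
    have hmem := hconv (hK v hv) (hK w hw) (a := φ v / (φ v + φ w)) (b := φ w / (φ v + φ w))
      (div_nonneg hv.2.le hadd.le) (div_nonneg hw.2.le hadd.le)
      (by rw [← add_div, div_self hadd.ne'])
    have he : (φ v / (φ v + φ w)) • (φ v)⁻¹ • v + (φ w / (φ v + φ w)) • (φ w)⁻¹ • w =
        (φ v + φ w)⁻¹ • (v + w) := by
      have h1 := hv.2.ne'
      have h2 := hw.2.ne'
      rw [smul_smul, smul_smul, smul_add]
      congr 2 <;> field_simp
    rw [he] at hmem
    obtain ⟨p, hp, hpe⟩ := hmem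
    have := posCone_smul_mem hadd (chartCoord_mem_posCone (hφ hp) hp)
    rwa [hpe, smul_inv_smul₀ hadd.ne'] at this

lemma posCone_eq_or_eq_neg (hψ : Ω ⊆ affineChart ψ) (hφ : Ω ⊆ affineChart φ)
    (hcone : IsConvexCone (posCone Ω φ)) :
    posCone Ω ψ = posCone Ω φ ∨ posCone Ω ψ = -posCone Ω φ := by
  have hneg : ∀ v ∈ doubleCone Ω, -v ∈ doubleCone Ω := fun v hv => by
    simpa using smul_mem_doubleCone hv (c := -1) (by norm_num)
  rcases hcone.pos_or_neg ψ (fun v hv => apply_ne_zero_of_mem_doubleCone hψ hv.1) with h | h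
  · left
    refine Set.Subset.antisymm (fun v hv => ⟨hv.1, ?_⟩) fun v hv => ⟨hv.1, h v hv⟩
    by_contra! hle
    have hlt := lt_of_le_of_ne hle (apply_ne_zero_of_mem_doubleCone hφ hv.1)
    have := h (-v) ⟨hneg v hv.1, by simpa using hlt⟩
    have := hv.2
    simp only [map_neg] at *
    linarith
  · right
    refine Set.Subset.antisymm (fun v hv => ⟨hneg v hv.1, ?_⟩) fun v hv => ?_
    · by_contra! hle
      rw [map_neg] at hle
      have hlt := lt_of_le_of_ne (neg_nonpos.mp hle) (apply_ne_zero_of_mem_doubleCone hφ hv.1).symm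
      have := h v ⟨hv.1, hlt⟩
      have := hv.2
      linarith
    · rw [Set.mem_neg] at hv
      exact ⟨by simpa using hneg _ hv.1, by simpa using h _ hv⟩

lemma IsProperlyConvexOpen.isConvexCone_posCone (hΩ : IsProperlyConvexOpen Ω)
    (hψ : Ω ⊆ affineChart ψ) : IsConvexCone (posCone Ω ψ) := by
  obtain ⟨φ, _, hφ, hconv⟩ := hΩ.isConvex
  have hcone := isConvexCone_posCone_of_convex hφ hconv
  rcases posCone_eq_or_eq_neg hψ hφ hcone with h | h
  · rwa [h]
  · rw [h]; exact hcone.neg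

lemma pos_of_mem_closure_posCone (hψ : closure Ω ⊆ affineChart ψ) {v : Fin (n + 1) → ℝ}
    (hv : v ∈ closure (posCone Ω ψ)) (h0 : v ≠ 0) : 0 < ψ v := by
  have h1 : ψ v ≠ 0 := apply_ne_zero_of_mem_doubleCone hψ
    (mem_doubleCone_closure (closure_mono (fun w hw => hw.1) hv) h0)
  have h2 : v ∈ {w | 0 ≤ ψ w} := closure_minimal (fun w hw => hw.2.le)
    (isClosed_Ici.preimage (LinearMap.continuous_of_finiteDimensional ψ)) hv
  exact lt_of_le_of_ne h2 h1.symm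

lemma chartCoord_mem_closure_posCone (hψ : closure Ω ⊆ affineChart ψ) {p : ProjSpace n}
    (hp : p ∈ closure Ω) : chartCoord ψ p ∈ closure (posCone Ω ψ) := by
  have h := chartCoord_mem_posCone (hψ hp) hp
  have hopen : IsOpen {v | 0 < ψ v} :=
    isOpen_Ioi.preimage (LinearMap.continuous_of_finiteDimensional ψ)
  have hmem : chartCoord ψ p ∈ closure ({v | 0 < ψ v} ∩ doubleCone Ω) :=
    hopen.inter_closure ⟨h.2, mem_closure_doubleCone h.1⟩
  refine closure_mono ?_ hmem
  exact fun v hv => ⟨hv.2, hv.1⟩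

/-! ### The Hilbert distance and the order of the cone -/

lemma exists_mem_frontier_sbtw (hΩ : IsProperlyConvexOpen Ω) (hψ : closure Ω ⊆ affineChart ψ)
    {p q : ProjSpace n} (hp : p ∈ Ω) (hq : q ∈ Ω) (hpq : p ≠ q) :
    ∃ a ∈ frontier Ω, Sbtw ℝ (chartCoord ψ p) (chartCoord ψ q) (chartCoord ψ a) := by
  have hψ' : Ω ⊆ affineChart ψ := subset_closure.trans hψ
  have hopen := isOpen_posCone hΩ.isOpen ψ
  obtain ⟨c, hc, hcf⟩ := exists_pos_mul_norm_le (hΩ.isConvexCone_posCone hψ') ψ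
    fun v => pos_of_mem_closure_posCone hψ
  have hne : chartCoord ψ p ≠ chartCoord ψ q := by
    intro he
    apply hpq
    rw [← mk_chartCoord (hψ' hp), ← mk_chartCoord (hψ' hq)]
    congr 1
  obtain ⟨τ, hτ, hcl, hnot⟩ := exists_mem_closure_notMem_of_ray hopen ψ hc hcf
    (chartCoord_mem_posCone (hψ' hq) hq) hne
    ((apply_chartCoord (hψ' hp)).trans (apply_chartCoord (hψ' hq)).symm)
  set x := chartCoord ψ p
  set y := chartCoord ψ q
  have hψa : ψ (x + τ • (y - x)) = 1 := by
    simp [x, y, apply_chartCoord (hψ' hp), apply_chartCoord (hψ' hq)]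
  have ha0 : x + τ • (y - x) ≠ 0 := by
    intro h
    rw [h, map_zero] at hψa
    exact zero_ne_one hψa
  have hcoord : chartCoord ψ (Projectivization.mk ℝ _ ha0) = x + τ • (y - x) := by
    rw [chartCoord_mk, hψa, inv_one, one_smul]
  refine ⟨Projectivization.mk ℝ _ ha0, ⟨?_, ?_⟩, ?_⟩
  · exact (mem_doubleCone_closure (closure_mono (fun w hw => hw.1) hcl) ha0).2
  · rw [hΩ.isOpen.interior_eq]
    exact fun h => hnot ⟨⟨ha0, h⟩, by rw [hψa]; exact one_pos⟩
  · rw [hcoord]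
    have hτ0 : τ ≠ 0 := by positivity
    refine ⟨⟨τ⁻¹, ⟨by positivity, inv_le_one_of_one_le₀ hτ.le⟩, ?_⟩, hne.symm, ?_⟩
    · simp [AffineMap.lineMap_apply, smul_smul, inv_mul_cancel₀ hτ0]
    · intro h
      have : (τ - 1) • (y - x) = 0 := by
        rw [sub_smul, one_smul]
        nth_rewrite 2 [h]
        rw [add_sub_cancel_left, sub_self]
      rcases smul_eq_zero.mp this with h' | h'
      · linarith
      · exact hne (sub_eq_zero.mp h').symm

/-- The two boundary points of the Hilbert distance exist, so its value is not a default value. -/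
lemma exists_isHilbertDist (hΩ : IsProperlyConvexOpen Ω) {p q : ProjSpace n} (hp : p ∈ Ω)
    (hq : q ∈ Ω) (hpq : p ≠ q) : ∃ r, IsHilbertDist Ω p q r := by
  obtain ⟨ψ, h0, hψ⟩ := hΩ.closure_subset
  obtain ⟨a, ha, hsa⟩ := exists_mem_frontier_sbtw hΩ hψ hp hq hpq
  obtain ⟨b, hb, hsb⟩ := exists_mem_frontier_sbtw hΩ hψ hq hp hpq.symm
  exact ⟨_, ψ, h0, hψ, a, ha, b, hb, hsb.symm, hsa, rfl⟩

/-- If `x` lies strictly between `b` and `y`, then `t • x - y` is a positive multiple of `b`, for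
the ratio `t` of the distances of `y` and `x` to `b`. -/
lemma exists_smul_sub_eq_of_sbtw {b x y : Fin (n + 1) → ℝ} (h : Sbtw ℝ b x y) :
    ∃ t : ℝ, 1 < t ∧ t • x - y = (t - 1) • b ∧
      ‖WithLp.toLp 2 (b - y)‖ = t * ‖WithLp.toLp 2 (b - x)‖ := by
  obtain ⟨⟨u, hu, hux⟩, hxb, hxy⟩ := h
  have hu0 : 0 < u := lt_of_le_of_ne hu.1 (by rintro rfl; exact hxb (by simp [← hux]))
  have hu1 : u < 1 := lt_of_le_of_ne hu.2 (by rintro rfl; exact hxy (by simp [← hux]))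
  have hx : x = u • (y - b) + b := by rw [← hux, AffineMap.lineMap_apply]; rfl
  refine ⟨u⁻¹, (one_lt_inv₀ hu0).mpr hu1, ?_, ?_⟩
  · rw [hx, smul_add, inv_smul_smul₀ hu0.ne', sub_smul, one_smul]
    abel
  · have : b - y = u⁻¹ • (b - x) := by
      have : b - x = u • (b - y) := by rw [hx, smul_sub, smul_sub]; abel
      rw [this, inv_smul_smul₀ hu0.ne']
    rw [this, WithLp.toLp_smul, norm_smul, Real.norm_eq_abs, abs_of_pos (inv_pos.mpr hu0)]

/-- The Hilbert distance bounds the distance of the two points for the order of the cone: suitable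
vectors of the two lines satisfy `y ≤ t • x` and `x ≤ s • y`, where `s * t` is the
cross-ratio. -/
lemma exists_order_of_isHilbertDist {p q : ProjSpace n} (hp : p ∈ Ω) (hq : q ∈ Ω) {r : ℝ}
    (h : IsHilbertDist Ω p q r)
    (hcone : ∀ ψ : Module.Dual ℝ (Fin (n + 1) → ℝ), closure Ω ⊆ affineChart ψ →
      IsConvexCone (posCone Ω ψ)) :
    ∃ ψ : Module.Dual ℝ (Fin (n + 1) → ℝ), closure Ω ⊆ affineChart ψ ∧
      ∃ x ∈ posCone Ω ψ, ∃ y ∈ posCone Ω ψ, (∃ hx, Projectivization.mk ℝ x hx = p) ∧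
      (∃ hy, Projectivization.mk ℝ y hy = q) ∧ ∃ s t : ℝ, 0 < s ∧ 0 < t ∧
      s * t = Real.exp (2 * r) ∧ t • x - y ∈ closure (posCone Ω ψ) ∧
      s • y - x ∈ closure (posCone Ω ψ) := by
  obtain ⟨ψ, _, hψ, a, ha, b, hb, hsb, hsa, rfl⟩ := h
  have hψ' : Ω ⊆ affineChart ψ := subset_closure.trans hψ
  have hK := (hcone ψ hψ).closure
  obtain ⟨t, ht, het, hnt⟩ := exists_smul_sub_eq_of_sbtw hsb
  obtain ⟨s, hs, hes, hns⟩ := exists_smul_sub_eq_of_sbtw hsa.symm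
  refine ⟨ψ, hψ, chartCoord ψ p, chartCoord_mem_posCone (hψ' hp) hp, chartCoord ψ q,
    chartCoord_mem_posCone (hψ' hq) hq, ⟨_, mk_chartCoord (hψ' hp)⟩, ⟨_, mk_chartCoord (hψ' hq)⟩,
    s, t, by linarith, by linarith, ?_, ?_, ?_⟩
  · have hne : ∀ v w : Fin (n + 1) → ℝ, v ≠ w → ‖WithLp.toLp 2 (v - w)‖ ≠ 0 := by
      intro v w h
      rw [norm_ne_zero_iff]
      intro h0
      exact h (sub_eq_zero.mp ((WithLp.toLp_injective 2) h0))
    have h1 := hne _ _ hsb.2.1.symm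
    have h2 := hne _ _ hsa.2.2.symm
    have hcr : crossRatio ψ a b p q = s * t := by
      rw [crossRatio, chartDist, chartDist, chartDist, chartDist, hnt, hns]
      field_simp
    have hst : 0 < s * t := by nlinarith
    rw [hcr, ← mul_assoc, mul_one_div_cancel two_ne_zero, one_mul, Real.exp_log hst]
  · rw [het]
    exact hK.smul_mem _ (by linarith) _ (chartCoord_mem_closure_posCone hψ hb.1)
  · rw [hes]
    exact hK.smul_mem _ (by linarith) _ (chartCoord_mem_closure_posCone hψ ha.1)

lemma exists_order_of_mem (hΩ : IsProperlyConvexOpen Ω) (hφ : closure Ω ⊆ affineChart φ)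
    {p q : ProjSpace n} (hp : p ∈ Ω) (hq : q ∈ Ω) :
    ∃ x ∈ posCone Ω φ, ∃ y ∈ posCone Ω φ, (∃ hx, Projectivization.mk ℝ x hx = p) ∧
      (∃ hy, Projectivization.mk ℝ y hy = q) ∧ ∃ s t : ℝ, 0 < s ∧ 0 < t ∧
      s * t = Real.exp (2 * hilbertDist Ω p q) ∧ t • x - y ∈ closure (posCone Ω φ) ∧
      s • y - x ∈ closure (posCone Ω φ) := by
  have hφ' : Ω ⊆ affineChart φ := subset_closure.trans hφ
  rcases eq_or_ne p q with rfl | hpq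
  · have hmem := chartCoord_mem_posCone (hφ' hp) hp
    have h0 := (hΩ.isConvexCone_posCone hφ').zero_mem_closure hmem
    refine ⟨_, hmem, _, hmem, ⟨_, mk_chartCoord (hφ' hp)⟩, ⟨_, mk_chartCoord (hφ' hp)⟩, 1, 1,
      one_pos, one_pos, ?_, ?_, ?_⟩
    · simp [hilbertDist]
    · simpa using h0
    · simpa using h0
  have hex := exists_isHilbertDist hΩ hp hq hpq
  have hdist : IsHilbertDist Ω p q (hilbertDist Ω p q) := by
    rw [hilbertDist, dif_pos ⟨hpq, hex⟩]
    exact hex.choose_spec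
  obtain ⟨ψ, hψ, x, hx, y, hy, ⟨hx0, hxp⟩, ⟨hy0, hyq⟩, s, t, hs, ht, hst, h1, h2⟩ :=
    exists_order_of_isHilbertDist hp hq hdist
      fun ψ hψ => hΩ.isConvexCone_posCone (subset_closure.trans hψ)
  rcases posCone_eq_or_eq_neg (subset_closure.trans hψ) hφ' (hΩ.isConvexCone_posCone hφ')
    with h | h
  · rw [h] at hx hy h1 h2
    exact ⟨x, hx, y, hy, ⟨hx0, hxp⟩, ⟨hy0, hyq⟩, s, t, hs, ht, hst, h1, h2⟩
  · rw [h] at hx hy h1 h2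
    rw [← neg_closure] at h1 h2
    have mkneg : ∀ v : Fin (n + 1) → ℝ, ∀ hv : v ≠ 0,
        Projectivization.mk ℝ (-v) (neg_ne_zero.mpr hv) = Projectivization.mk ℝ v hv :=
      fun v hv => (Projectivization.mk_eq_mk_iff' ℝ _ _ _ _).mpr ⟨-1, by simp⟩
    refine ⟨-x, hx, -y, hy, ⟨_, (mkneg x hx0).trans hxp⟩, ⟨_, (mkneg y hy0).trans hyq⟩, s, t, hs,
      ht, hst, ?_, ?_⟩
    · rw [Set.mem_neg] at h1
      convert! h1 using 1
      rw [smul_neg]; abel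
    · rw [Set.mem_neg] at h2
      convert! h2 using 1
      rw [smul_neg]; abel

/-! ### Automorphisms of a properly convex open set -/

lemma smul_mem_doubleCone_of_mem_aut {γ : SL(n + 1, ℝ)} (hγ : γ ∈ Aut Ω) {v : Fin (n + 1) → ℝ}
    (hv : v ∈ doubleCone Ω) : γ • v ∈ doubleCone Ω := by
  obtain ⟨h, hv⟩ := hv
  refine ⟨(smul_ne_zero_iff_ne γ).mpr h, ?_⟩
  have hst : γ • Ω = Ω := hγ
  have := Set.smul_mem_smul_set (a := γ) hv
  rwa [hst] at this

lemma exists_sign_smul_mem_posCone (hΩ : IsProperlyConvexOpen Ω) (hφ : Ω ⊆ affineChart φ)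
    {γ : SL(n + 1, ℝ)} (hγ : γ ∈ Aut Ω) :
    ∃ σ : ℝ, (σ = 1 ∨ σ = -1) ∧ ∀ v ∈ posCone Ω φ, σ • γ • v ∈ posCone Ω φ := by
  have hne : ∀ v ∈ posCone Ω φ, (φ ∘ₗ γ.1.mulVecLin) v ≠ 0 := fun v hv =>
    apply_ne_zero_of_mem_doubleCone hφ (smul_mem_doubleCone_of_mem_aut hγ hv.1)
  rcases (hΩ.isConvexCone_posCone hφ).pos_or_neg (φ ∘ₗ γ.1.mulVecLin) hne with h | h
  · refine ⟨1, .inl rfl, fun v hv => ?_⟩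
    rw [one_smul]
    exact ⟨smul_mem_doubleCone_of_mem_aut hγ hv.1, h v hv⟩
  · refine ⟨-1, .inr rfl, fun v hv => ⟨smul_mem_doubleCone
      (smul_mem_doubleCone_of_mem_aut hγ hv.1) (by norm_num), ?_⟩⟩
    rw [map_smul, smul_eq_mul, neg_one_mul, neg_pos]
    exact h v hv

/-- An automorphism or its opposite preserves the cone over `Ω`, hence its order, and so an
automorphism which moves `p` little for the Hilbert distance dilates the order ball at `p` little. -/
lemma dilatesBy_of_mem_aut (hΩ : IsProperlyConvexOpen Ω) (hφ : closure Ω ⊆ affineChart φ)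
    {p : ProjSpace n} (hp : p ∈ Ω) {γ : SL(n + 1, ℝ)} (hγ : γ ∈ Aut Ω) :
    DilatesBy (orderBall (closure (posCone Ω φ)) (chartCoord φ p))
      (Real.exp (2 * hilbertDist Ω p (γ • p))) γ := by
  have hφ' : Ω ⊆ affineChart φ := subset_closure.trans hφ
  have hK := (hΩ.isConvexCone_posCone hφ').closure
  have hγp : γ • p ∈ Ω := by
    have hst : γ • Ω = Ω := hγ
    rw [← hst]
    exact Set.smul_mem_smul_set hp
  obtain ⟨x, hx, y, hy, ⟨hx0, hxp⟩, ⟨hy0, hyq⟩, s, t, hs, ht, hst, h1, h2⟩ :=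
    exists_order_of_mem hΩ hφ hp hγp
  obtain ⟨σ, hσ, hγC⟩ := exists_sign_smul_mem_posCone hΩ hφ' hγ
  obtain ⟨σ', hσ', hγC'⟩ := exists_sign_smul_mem_posCone hΩ hφ' (inv_mem hγ)
  set x₀ := chartCoord φ p with hx₀
  have hx₀C : x₀ ∈ posCone Ω φ := chartCoord_mem_posCone (hφ' hp) hp
  have hscal : ∀ v ∈ posCone Ω φ, ∀ c : ℝ, c • v ∈ posCone Ω φ → 0 < c := by
    intro v hv c hc
    have := hc.2
    rw [map_smul, smul_eq_mul] at this
    exact (pos_iff_pos_of_mul_pos this).mpr hv.2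
  have hσσ : σ' = σ := by
    have := hγC' _ (hγC x₀ hx₀C)
    rw [smul_comm γ⁻¹ σ, inv_smul_smul, smul_smul] at this
    have := hscal _ hx₀C _ this
    rcases hσ with rfl | rfl <;> rcases hσ' with rfl | rfl <;> norm_num at *
  subst hσσ
  have hσ2 : σ' * σ' = 1 := by rcases hσ with rfl | rfl <;> norm_num
  have hclos : ∀ η : SL(n + 1, ℝ), (∀ v ∈ posCone Ω φ, σ' • η • v ∈ posCone Ω φ) →
      ∀ v ∈ closure (posCone Ω φ), σ' • η • v ∈ closure (posCone Ω φ) := by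
    intro η h v hv
    have hcont : Continuous fun w : Fin (n + 1) → ℝ => σ' • η • w :=
      (LinearMap.continuous_of_finiteDimensional η.1.mulVecLin).const_smul σ'
    exact map_mem_closure (f := fun w => σ' • η • w) hcont hv h
  -- `x` and `y` are positive multiples of `x₀` and of its image in the cone.
  obtain ⟨ν, _, hν⟩ := mk_eq_of_smul hx0 (chartCoord_ne_zero (hφ' hp))
    (hxp.trans (mk_chartCoord (hφ' hp)).symm)
  have hνpos : 0 < ν := hscal _ hx₀C _ (hν ▸ hx)
  obtain ⟨μ, hμ0, hμ⟩ : ∃ μ : ℝ, 0 < μ ∧ y = μ • σ' • γ • x₀ := by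
    have h0 := (smul_ne_zero_iff_ne γ).mpr (chartCoord_ne_zero (hφ' hp))
    have hmk : Projectivization.mk ℝ (γ • x₀) h0 = γ • p := by
      rw [← Projectivization.smul_mk γ (chartCoord_ne_zero (hφ' hp)), mk_chartCoord (hφ' hp)]
    obtain ⟨μ, _, hμ⟩ := mk_eq_of_smul hy0 h0 (hyq.trans hmk.symm)
    have he : y = (μ * σ') • σ' • γ • x₀ := by
      rw [smul_smul, mul_assoc, hσ2, mul_one, hμ]
    exact ⟨μ * σ', hscal _ (hγC _ hx₀C) _ (he ▸ hy), he⟩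
  change x = ν • x₀ at hν
  rw [hν, hμ] at h1 h2
  refine ⟨s * μ / ν, t * ν / μ, by positivity, by positivity, ?_, ?_, ?_⟩
  · rw [← hst]
    apply le_of_eq
    field_simp
  · refine smul_mem_smul_orderBall hK hσ (hclos γ hγC) (by positivity) ?_
    have := hK.smul_mem μ⁻¹ (by positivity) _ h1
    rw [smul_sub, inv_smul_smul₀ hμ0.ne', smul_smul, smul_smul] at this
    convert! this using 3
    field_simp
  · refine smul_mem_smul_orderBall hK hσ (hclos γ⁻¹ hγC') (by positivity) ?_
    have := hclos γ⁻¹ hγC' _ (hK.smul_mem ν⁻¹ (by positivity) _ h2)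
    rw [smul_sub, inv_smul_smul₀ hνpos.ne', smul_smul, smul_smul, smul_sub, smul_sub,
      smul_comm γ⁻¹, smul_comm γ⁻¹, inv_smul_smul, smul_comm σ', smul_smul σ', hσ2, one_smul] at this
    convert! this using 3
    field_simp

end HilbertGeometry

/-- The Kazhdan–Margulis–Zassenhaus lemma for Hilbert geometries. -/
theorem mainTheorem1 (n : ℕ) :
    ∃ ε : ℝ, 0 < ε ∧ ∃ m : ℕ,
      ∀ Ω : Set (HilbertGeometry.ProjSpace n), HilbertGeometry.IsProperlyConvexOpen Ω →
      ∀ Γ : Subgroup SL(n + 1, ℝ), Γ ≤ HilbertGeometry.Aut Ω → DiscreteTopology Γ →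
      ∀ x ∈ Ω,
        Group.IsVirtuallyNilpotent (HilbertGeometry.smallSubgroup Ω Γ x ε) ∧
        ∃ N : Subgroup (HilbertGeometry.smallSubgroup Ω Γ x ε),
          Group.IsNilpotent N ∧ N.FiniteIndex ∧ N.index ≤ m := by
  obtain ⟨ε, hε, m, h⟩ := exists_isNilpotent_index_le_of_dilatesBy n
  refine ⟨ε, hε, m, fun Ω hΩ Γ hΓ hdisc x hx => ?_⟩
  obtain ⟨φ, _, hφ⟩ := hΩ.closure_subset
  have hφ' : Ω ⊆ HilbertGeometry.affineChart φ := subset_closure.trans hφ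
  obtain ⟨c, hc, hcf⟩ := exists_pos_mul_norm_le (hΩ.isConvexCone_posCone hφ') φ
    fun v => HilbertGeometry.pos_of_mem_closure_posCone hφ
  have hle : HilbertGeometry.smallSubgroup Ω Γ x ε ≤ Γ :=
    (Subgroup.closure_le _).mpr fun γ hγ => hγ.1
  obtain ⟨N, hN, hfin, hindex⟩ := h (HilbertGeometry.smallSubgroup Ω Γ x ε)
    (DiscreteTopology.of_subset hdisc hle) _ (isCompact_orderBall φ hc hcf _)
    (orderBall_mem_nhds (HilbertGeometry.isOpen_posCone hΩ.isOpen φ)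
      (HilbertGeometry.chartCoord_mem_posCone (hφ' hx) hx)) _ rfl
    fun γ hγ => (HilbertGeometry.dilatesBy_of_mem_aut hΩ hφ hx (hΓ hγ.1)).mono
      (Real.exp_le_exp.mpr (mul_le_mul_of_nonneg_left hγ.2 zero_le_two))
  exact ⟨⟨N, hN, hfin⟩, N, hN, hfin, hindex⟩
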